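/- Let $G$ be a group, $H\le G$ a subgroup and $\theta\colon H\to G$ an injective homomorphism, and let $\Gamma=\operatorname{HNN}(G,H,\theta)=\langle G,\tau\mid \tau^{-1}h\tau=\theta(h)\text{ for all }h\in H\rangle$. Assume that $\Gamma$ is non-ascending, i.e. $H\neq G$ and $\theta(H)\neq G$. Put $H_{-1}=H$, $H_1=\theta(H)$, and for $\varepsilon\in\{\pm1\}$ let $S_\varepsilon\ni 1$ be a system of representatives of the left cosets of $H_\varepsilon$ in $G$. Every $g\in\Gamma$ has a unique normal form $g=g_1\tau^{\varepsilon_1}\cdots g_n\tau^{\varepsilon_n}g_{n+1}$ with $n\ge 0$, $\varepsilon_i\in\{\pm1\}$, $g_{n+1}\in G$, $g_i\in S_{-\varepsilon_i}$ for $1\le i\le n$, and such that $g_i=1$ implies $\varepsilon_{i-1}=\varepsilon_i$ for $2\le i\le n$. Let $T_\varepsilon^\dagger$ be the set of those $g\in\Gamma$ whose normal form has $n\ge1$, $\varepsilon_1=\varepsilon$ and $g_1=1$. Define the quasi-kernels $$K_\varepsilon=\bigcap_{r\in\Gamma\setminus T_\varepsilon^\dagger} rHr^{-1},\qquad \varepsilon\in\{\pm1\}.$$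 Then the normal closures of $K_{-1}$ and $K_1$ in $\Gamma$ coincide; denote this subgroup by $\operatorname{int}\Gamma$. The following are equivalent: (i) $\operatorname{int}\Gamma=\{1\}$; (ii) $K_\varepsilon=\{1\}$ for some $\varepsilon\in\{\pm1\}$, or equivalently for both; (iii) for every finite $F\subseteq\Gamma\setminus\{1\}$ there is $g\in\Gamma$ with $gFg^{-1}\cap G=\emptyset$; (iv) for every finite $F\subseteq\Gamma\setminus\{1\}$ there is $g\in\Gamma$ with $gFg^{-1}\cap H=\emptyset$; (v) for every finite $F\subseteq G\setminus\{1\}$ there is $g\in\Gamma$ with $gFg^{-1}\cap H=\emptyset$; (vi) for every finite $F\subseteq H\setminus\{1\}$ there is $g\in\Gamma$ with $gFg^{-1}\cap H=\emptyset$. Moreover, if these conditions hold, then $\Gamma$ is a Powers group: $\Gamma\ne\{1\}$, and for every finite $F\subseteq\Gamma\setminus\{1\}$ and every integer $N\ge1$ there are a partition $\Gamma=C\sqcup D$ and $\gamma_1,\dots,\gamma_N\in\Gamma$ such that $fC\cap C=\emptyset$ for all $f\in F$ and $\gamma_jD\cap\gamma_kD=\emptyset$ for all $j\neq k$. In particular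 $\Gamma$ is $C^*$-simple: the reduced group $C^*$-algebra $C^*_r(\Gamma)$, i.e. the $C^*$-subalgebra of $B(\ell^2(\Gamma))$ generated by the left regular representation, has no closed two-sided ideals other than $0$ and $C^*_r(\Gamma)$. -/

import Mathlib

/-! ## Words, normal forms and quasi-kernels in an HNN extension

Throughout, `H` and `K` are subgroups of `G` and `θ : H ≃* K`, that is, `θ` is an injective
homomorphism from `H` to `G` with image `θ(H) = K`. Mathlib's `HNNExtension G H K θ` has a stable
letter `t` with `t h t⁻¹ = θ(h)`, so `τ = t⁻¹` satisfies `τ⁻¹ h τ = θ(h)`. -/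

namespace HNNPowers

section HNN

variable {G : Type*} [Group G] {H K : Subgroup G}

/-- The stable letter `τ` of `HNN(G, H, θ) = ⟨G, τ ∣ τ⁻¹ h τ = θ(h), h ∈ H⟩`. -/
def stable (θ : H ≃* K) : HNNExtension G H K θ := (HNNExtension.t)⁻¹

theorem stable_inv_mul_of_mul_stable (θ : H ≃* K) (h : H) :
    (stable θ)⁻¹ * HNNExtension.of (h : G) * stable θ = HNNExtension.of ((θ h : K) : G) := by
  rw [HNNExtension.equiv_eq_conj, stable, inv_inv]

/-- The HNN extension is non-ascending: `H ≠ G` and `θ(H) ≠ G`. -/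
def NonAscending (_θ : H ≃* K) : Prop := H ≠ ⊤ ∧ K ≠ ⊤

/-- The subgroups `H_{-1} = H` and `H_1 = θ(H)` of `G`. -/
def assocSubgroup (H K : Subgroup G) (ε : ℤˣ) : Subgroup G := if ε = 1 then K else H

/-- Systems `S_{-1}`, `S_1` of representatives of the left cosets of `H_{-1} = H` and
`H_1 = θ(H)` in `G`, both containing `1`. -/
structure LeftReps (H K : Subgroup G) where
  /-- the set `S_ε` -/
  reps : ℤˣ → Set G
  /-- each element of `G` is uniquely a product `s * h` with `s ∈ S_ε` and `h ∈ H_ε` -/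
  isComplement : ∀ ε, Subgroup.IsComplement (reps ε) (assocSubgroup H K ε : Set G)
  one_mem : ∀ ε, (1 : G) ∈ reps ε

/-- The element `g₁ τ^{ε₁} ⋯ gₙ τ^{εₙ} g` of the HNN extension, for the list
`w = [(g₁, ε₁), …, (gₙ, εₙ)]`. -/
def wordProd (θ : H ≃* K) (w : List (G × ℤˣ)) (g : G) : HNNExtension G H K θ :=
  (w.map fun p => HNNExtension.of p.1 * stable θ ^ (p.2 : ℤ)).prod * HNNExtension.of g

/-- `g₁ τ^{ε₁} ⋯ gₙ τ^{εₙ} g` (with `g ∈ G` arbitrary) is in normal form: `gᵢ ∈ S_{-εᵢ}` for all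
`i`, and `gᵢ = 1` implies `εᵢ₋₁ = εᵢ` for `2 ≤ i ≤ n`. -/
def IsNormal (S : LeftReps H K) (w : List (G × ℤˣ)) : Prop :=
  (∀ p ∈ w, p.1 ∈ S.reps (-p.2)) ∧ w.IsChain (fun p q => q.1 = 1 → p.2 = q.2)

/-- The set `T_ε†` of elements of length `n ≥ 1`, of type `ε₁ = ε` and with initial letter
`g₁ = 1`, read off from the normal form. -/
def daggerSet (θ : H ≃* K) (S : LeftReps H K) (ε : ℤˣ) : Set (HNNExtension G H K θ) :=
  {x | ∃ (w : List (G × ℤˣ)) (g : G), IsNormal S ((1, ε) :: w) ∧ x = wordProd θ ((1, ε) :: w) g}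

/-- The group `G` as a subgroup of the HNN extension. -/
def baseG (θ : H ≃* K) : Subgroup (HNNExtension G H K θ) := (HNNExtension.of).range

/-- The group `H` as a subgroup of the HNN extension. -/
def baseH (θ : H ≃* K) : Subgroup (HNNExtension G H K θ) := H.map HNNExtension.of

/-- The quasi-kernel `K_ε`, the intersection of the conjugates `r H r⁻¹` over all `r` outside
`T_ε†`. -/
def quasiKernel (θ : H ≃* K) (S : LeftReps H K) (ε : ℤˣ) : Subgroup (HNNExtension G H K θ) :=
  ⨅ r ∈ (daggerSet θ S ε)ᶜ, (baseH θ).map (MulAut.conj r).toMonoidHom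

/-- The interior of the HNN extension: the normal closure of the quasi-kernel `K_{-1}`. In the
non-ascending case the normal closures of the two quasi-kernels agree, which is part of the main
statement. -/
def interior (θ : H ≃* K) (S : LeftReps H K) : Subgroup (HNNExtension G H K θ) :=
  Subgroup.normalClosure (quasiKernel θ S (-1) : Set (HNNExtension G H K θ))

end HNN

/-- Each finite subset `F` of `X ∖ {1}` has a conjugate `g F g⁻¹` that does not meet `Y`. -/
def FiniteConjAvoids {Γ : Type*} [Group Γ] (X Y : Set Γ) : Prop :=
  ∀ F : Set Γ, F.Finite → F ⊆ X \ {1} → ∃ g : Γ, ((fun f => g * f * g⁻¹) '' F) ∩ Y = ∅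

/-- Powers groups: `Γ ≠ 1` and, for every finite `F ⊆ Γ ∖ {1}` and every `N ≥ 1`, there are a
partition `Γ = C ⊔ D` and `γ₁, …, γ_N ∈ Γ` such that `f C ∩ C = ∅` for all `f ∈ F` and
`γⱼ D ∩ γₖ D = ∅` for all `j ≠ k`. -/
def IsPowersGroup (Γ : Type*) [Group Γ] : Prop :=
  Nontrivial Γ ∧
  ∀ F : Set Γ, F.Finite → (1 : Γ) ∉ F → ∀ N : ℕ, 1 ≤ N →
    ∃ (C D : Set Γ) (γ : Fin N → Γ), C ∪ D = Set.univ ∧ Disjoint C D ∧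
      (∀ f ∈ F, Disjoint ((fun x => f * x) '' C) C) ∧
      ∀ j k, j ≠ k → Disjoint ((fun x => γ j * x) '' D) ((fun x => γ k * x) '' D)

/-! ## The reduced group `C*`-algebra -/

section CStar

variable (Γ : Type*) [Group Γ]

/-- The Hilbert space `ℓ²(Γ)`. -/
abbrev ell2 : Type _ := lp (fun _ : Γ => ℂ) 2

variable {Γ}

theorem memℓp_translate (g : Γ) (ξ : ell2 Γ) :
    Memℓp (fun h => (ξ : Γ → ℂ) (g⁻¹ * h)) (2 : ENNReal) := by
  have h := lp.memℓp ξ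
  rw [memℓp_gen_iff (by norm_num)] at h ⊢
  exact h.comp_injective (mul_right_injective g⁻¹)

/-- The operator `λ(g)` of the left regular representation, `(λ(g)ξ)(h) = ξ(g⁻¹h)`, as a linear
isometry. -/
noncomputable def leftRegIsometry (g : Γ) : ell2 Γ →ₗᵢ[ℂ] ell2 Γ where
  toFun ξ := ⟨fun h => (ξ : Γ → ℂ) (g⁻¹ * h), memℓp_translate g ξ⟩
  map_add' _ _ := rfl
  map_smul' _ _ := rfl
  norm_map' ξ := by
    rw [lp.norm_eq_tsum_rpow (by norm_num), lp.norm_eq_tsum_rpow (by norm_num)]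
    congr 1
    exact (Equiv.mulLeft g⁻¹).tsum_eq (fun h => ‖(ξ : Γ → ℂ) h‖ ^ (2 : ENNReal).toReal)

/-- The operator `λ(g)` as an element of `B(ℓ²(Γ))`. -/
noncomputable def leftReg (g : Γ) : ell2 Γ →L[ℂ] ell2 Γ :=
  (leftRegIsometry g).toContinuousLinearMap

theorem leftReg_single [DecidableEq Γ] (g h : Γ) :
    leftReg g (lp.single 2 h (1 : ℂ)) = lp.single 2 (g * h) (1 : ℂ) := by
  ext x
  change (lp.single 2 h (1 : ℂ) : ell2 Γ) (g⁻¹ * x) = (lp.single 2 (g * h) (1 : ℂ) : ell2 Γ) x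
  rw [lp.single_apply, lp.single_apply, Pi.single_apply, Pi.single_apply]
  simp only [inv_mul_eq_iff_eq_mul]

variable (Γ)

/-- The reduced group `C*`-algebra, the closed star subalgebra of `B(ℓ²(Γ))` generated by all
`λ(g)`. -/
noncomputable def reducedCStar : StarSubalgebra ℂ (ell2 Γ →L[ℂ] ell2 Γ) :=
  (StarAlgebra.adjoin ℂ (Set.range (leftReg (Γ := Γ)))).topologicalClosure

/-- `Γ` is `C*`-simple: its reduced `C*`-algebra has no closed two-sided ideals besides `0` and
the whole algebra. -/
def IsCStarSimple : Prop :=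
  ∀ I : TwoSidedIdeal (reducedCStar Γ), IsClosed {a : reducedCStar Γ | a ∈ I} → I = ⊥ ∨ I = ⊤

end CStar

end HNNPowers

/-! Γ acts on its Bass–Serre tree: the vertices are the cosets xG, and the edge xH joins xG to xτG.
The set xT_ε† (`halfTree`) consists of the elements lying beyond the edge that leaves xG towards
xτ^εG. Its complement is again a half-tree, and two half-trees gT_ε†, g'T_δ† with g, g' ∈ G are
equal or disjoint. An element of K_ε fixes every edge rH with r outside T_ε†. Up to conjugation,
K_{-1} = 1 thus says that only 1 fixes all edges rH with r in T_1†.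

If K_{-1} = 1, each f ≠ 1 moves a vertex of every half-tree (`exists_conj_notMem_baseG`). Since Γ is
non-ascending, at least four directions leave each vertex, so one can choose a smaller half-tree
that f moves off itself (`exists_halfTree_disjoint`). Shrinking once for each f ∈ F gives C; its
complement is a half-tree and has arbitrarily many disjoint translates, which is the Powers
property. Every f ∈ F moves every vertex of C, so a conjugate of F avoids G. Conversely, if k ≠ 1
lies in K_ε and g ∉ H_{-ε}, each edge of the tree is fixed by k or by gkg⁻¹, so no conjugate of {k,
gkg⁻¹} avoids H.

C*-simplicity is Powers' averaging argument: suitable averages of conjugates of a trace-one element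
of an ideal are invertible (`norm_sum_le_of_compressesToZero`, `IsPowersGroup.exists_average`). -/

namespace HNNPowers

/-! ### Normal forms and Britton's lemma -/

section NormalForm

variable {G : Type*} [Group G] {H K : Subgroup G} {θ : H ≃* K} {S : LeftReps H K}

theorem toSubgroup_neg (ε : ℤˣ) :
    HNNExtension.toSubgroup H K (-ε) = assocSubgroup H K ε := by
  rcases Int.units_eq_one_or ε with rfl | rfl <;>
    simp [HNNExtension.toSubgroup, assocSubgroup]

theorem units_eq_neg_of_ne {ε δ : ℤˣ} (h : ε ≠ δ) : δ = -ε := by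
  rcases Int.units_eq_one_or ε with rfl | rfl <;>
    rcases Int.units_eq_one_or δ with rfl | rfl <;> simp_all

theorem NonAscending.assocSubgroup_ne_top (h : NonAscending θ) (ε : ℤˣ) :
    assocSubgroup H K ε ≠ ⊤ := by
  unfold assocSubgroup
  split_ifs
  exacts [h.2, h.1]

theorem NonAscending.exists_notMem (h : NonAscending θ) (ε : ℤˣ) :
    ∃ g : G, g ∉ assocSubgroup H K ε := by
  by_contra! hc
  exact h.assocSubgroup_ne_top ε (eq_top_iff.2 fun g _ => hc g)

theorem stable_zpow_neg (ε : ℤˣ) :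
    stable θ ^ ((-ε : ℤˣ) : ℤ) = (stable θ ^ (ε : ℤ))⁻¹ := by
  rw [Units.val_neg, zpow_neg]

theorem of_mul_stable_zpow {ε : ℤˣ} {h : G} (hh : h ∈ assocSubgroup H K (-ε)) :
    ∃ h' ∈ assocSubgroup H K ε, (HNNExtension.of h : HNNExtension G H K θ) * stable θ ^ (ε : ℤ) =
      stable θ ^ (ε : ℤ) * HNNExtension.of h' := by
  rcases Int.units_eq_one_or ε with rfl | rfl
  · have hh' : h ∈ H := by simpa [assocSubgroup] using hh
    refine ⟨θ ⟨h, hh'⟩, by simp [assocSubgroup], ?_⟩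
    simpa [stable] using HNNExtension.of_mul_inv_t (φ := θ) ⟨h, hh'⟩
  · have hh' : h ∈ K := by simpa [assocSubgroup] using hh
    refine ⟨θ.symm ⟨h, hh'⟩, by simp [assocSubgroup], ?_⟩
    simpa [stable] using HNNExtension.of_mul_t (φ := θ) ⟨h, hh'⟩

theorem LeftReps.eq_one (S : LeftReps H K) {ε : ℤˣ} {s : G} (hs : s ∈ S.reps ε)
    (hs' : s ∈ assocSubgroup H K ε) : s = 1 := by
  have := (S.isComplement ε).1 (a₁ := (⟨s, hs⟩, ⟨1, (assocSubgroup H K ε).one_mem⟩))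
    (a₂ := (⟨1, S.one_mem ε⟩, ⟨s, hs'⟩)) (by simp)
  simpa using congrArg (fun p => (p.1 : G)) this

theorem LeftReps.exists_mul_eq (S : LeftReps H K) (ε : ℤˣ) (g : G) :
    ∃ s ∈ S.reps ε, ∃ h ∈ assocSubgroup H K ε, s * h = g := by
  obtain ⟨⟨s, h⟩, hsh⟩ := (S.isComplement ε).2 g
  exact ⟨s, s.2, h, h.2, hsh⟩

@[simp]
theorem wordProd_nil (g : G) : wordProd θ [] g = HNNExtension.of g := by
  simp [wordProd]

theorem wordProd_cons (p : G × ℤˣ) (w : List (G × ℤˣ)) (g : G) :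
    wordProd θ (p :: w) g = HNNExtension.of p.1 * (stable θ ^ (p.2 : ℤ) * wordProd θ w g) := by
  simp [wordProd, mul_assoc]

theorem wordProd_mul_of (w : List (G × ℤˣ)) (g g' : G) :
    wordProd θ w g * HNNExtension.of g' = wordProd θ w (g * g') := by
  simp [wordProd, mul_assoc]

theorem isNormal_nil : IsNormal S [] := by simp [IsNormal]

theorem isNormal_cons {p : G × ℤˣ} {w : List (G × ℤˣ)} :
    IsNormal S (p :: w) ↔
      p.1 ∈ S.reps (-p.2) ∧ (∀ q ∈ w.head?, q.1 = 1 → p.2 = q.2) ∧ IsNormal S w := by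
  simp only [IsNormal, List.forall_mem_cons, List.isChain_cons]
  tauto

theorem IsNormal.reps_mem_head {w : List (G × ℤˣ)} (hw : IsNormal S w) {q : G × ℤˣ}
    (hq : q ∈ w.head?) : q.1 ∈ S.reps (-q.2) :=
  hw.1 q (List.mem_of_mem_head? hq)

/-- Left multiplication of a normal form by an element of `G`. -/
theorem IsNormal.exists_of_mul {w : List (G × ℤˣ)} (hw : IsNormal S w) (a g : G) :
    ∃ (w' : List (G × ℤˣ)) (g' : G), IsNormal S w' ∧
      wordProd θ w' g' = HNNExtension.of a * wordProd θ w g ∧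
      ∀ q ∈ w'.head?, ∃ p ∈ w.head?, q.2 = p.2 ∧
        q.1⁻¹ * (a * p.1) ∈ assocSubgroup H K (-p.2) := by
  induction w generalizing a with
  | nil => exact ⟨[], a * g, isNormal_nil, by simp, by simp⟩
  | cons p w ih =>
    obtain ⟨hp, hpw, hw⟩ := isNormal_cons.1 hw
    obtain ⟨s, hs, h, hh, hsh⟩ := S.exists_mul_eq (-p.2) (a * p.1)
    obtain ⟨h', hh', hcomm⟩ := of_mul_stable_zpow (θ := θ) hh
    obtain ⟨w', g', hw', hprod, hhead⟩ := ih hw h'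
    refine ⟨(s, p.2) :: w', g', isNormal_cons.2 ⟨hs, fun q hq hq1 => ?_, hw'⟩, ?_, ?_⟩
    · obtain ⟨r, hr, hqr, hmem⟩ := hhead q hq
      by_contra hne
      have hrp : -r.2 = p.2 := by
        rw [← hqr, units_eq_neg_of_ne hne, neg_neg]
      -- If the sign changes, the next letter has its representatives taken modulo the subgroup
      -- containing h', so a new entry 1 forces the old entry to be 1 too.
      rw [hrp, hq1, inv_one, one_mul, Subgroup.mul_mem_cancel_left _ hh'] at hmem
      have hr1 := S.eq_one (hrp ▸ hw.reps_mem_head hr) hmem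
      exact hne ((hpw r hr hr1).trans hqr.symm)
    · rw [wordProd_cons, wordProd_cons, hprod, ← mul_assoc (HNNExtension.of a), ← map_mul, ← hsh,
        map_mul]
      simp only [← mul_assoc]
      rw [mul_assoc (HNNExtension.of s), ← hcomm]
      simp only [mul_assoc]
    · simp [← hsh, hh]

theorem IsNormal.exists_stable_mul {w : List (G × ℤˣ)} (hw : IsNormal S w) (ε : ℤˣ) (g : G) :
    ∃ w' : List (G × ℤˣ), IsNormal S w' ∧
      wordProd θ w' g = stable θ ^ (ε : ℤ) * wordProd θ w g := by
  by_cases h : IsNormal S ((1, ε) :: w)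
  · exact ⟨_, h, by simp [wordProd_cons]⟩
  · have h' : ∃ q ∈ w.head?, q.1 = 1 ∧ ε ≠ q.2 := by
      simpa [isNormal_cons, S.one_mem, hw] using h
    obtain ⟨⟨a, δ⟩, hq, rfl, hne⟩ := h'
    cases w with
    | nil => simp at hq
    | cons p w =>
      obtain rfl : p = (1, δ) := by simpa using hq
      refine ⟨w, (isNormal_cons.1 hw).2.2, ?_⟩
      rw [wordProd_cons, units_eq_neg_of_ne hne]
      simp

/-- Existence of normal forms. -/
theorem exists_isNormal (S : LeftReps H K) (x : HNNExtension G H K θ) :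
    ∃ (w : List (G × ℤˣ)) (g : G), IsNormal S w ∧ wordProd θ w g = x := by
  -- Left multiplication by x preserves the set of products of normal forms; x⁻¹ is carried along
  -- for the inverse case of the induction.
  suffices ∀ y : HNNExtension G H K θ, (∃ w g, IsNormal S w ∧ wordProd θ w g = y) →
      (∃ w g, IsNormal S w ∧ wordProd θ w g = x * y) ∧
      (∃ w g, IsNormal S w ∧ wordProd θ w g = x⁻¹ * y) by
    simpa using (this 1 ⟨[], 1, isNormal_nil, by simp⟩).1
  induction x using HNNExtension.induction_on with
  | of a =>
    rintro _ ⟨w, g, hw, rfl⟩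
    obtain ⟨w₁, g₁, h₁, h₁', -⟩ := hw.exists_of_mul (θ := θ) a g
    obtain ⟨w₂, g₂, h₂, h₂', -⟩ := hw.exists_of_mul (θ := θ) a⁻¹ g
    exact ⟨⟨w₁, g₁, h₁, h₁'⟩, ⟨w₂, g₂, h₂, by rw [h₂', map_inv]⟩⟩
  | t =>
    rintro _ ⟨w, g, hw, rfl⟩
    obtain ⟨w₁, h₁, h₁'⟩ := hw.exists_stable_mul (θ := θ) (-1) g
    obtain ⟨w₂, h₂, h₂'⟩ := hw.exists_stable_mul (θ := θ) 1 g
    exact ⟨⟨w₁, g, h₁, by simpa [stable] using h₁'⟩, ⟨w₂, g, h₂, by simpa [stable] using h₂'⟩⟩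
  | mul x y hx hy =>
    intro z hz
    refine ⟨?_, ?_⟩
    · rw [mul_assoc]
      exact (hx _ (hy z hz).1).1
    · rw [mul_inv_rev, mul_assoc]
      exact (hy _ (hx z hz).2).2
  | inv x hx =>
    intro y hy
    rw [inv_inv]
    exact (hx y hy).symm

/-- The first entry in `G` of the word `g₁ τ^{ε₁} ⋯ gₙ τ^{εₙ} g`. -/
def headEntry : List (G × ℤˣ) → G → G
  | [], g => g
  | p :: _, _ => p.1

/-- The word `g₁ τ^{ε₁} ⋯ gₙ τ^{εₙ} g` without its first entry, in the letters `t ^ u * g`. -/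
def tailLetters : List (G × ℤˣ) → G → List (ℤˣ × G)
  | [], _ => []
  | p :: w, g => (-p.2, headEntry w g) :: tailLetters w g

theorem of_headEntry_mul_prod (w : List (G × ℤˣ)) (g : G) :
    HNNExtension.of (headEntry w g) * ((tailLetters w g).map fun x =>
      (HNNExtension.t : HNNExtension G H K θ) ^ (x.1 : ℤ) * HNNExtension.of x.2).prod =
      wordProd θ w g := by
  induction w with
  | nil => simp [headEntry, tailLetters]
  | cons p w ih =>
    rw [wordProd_cons, ← ih]
    simp [headEntry, tailLetters, stable, mul_assoc]

/-- An entry that would permit a cancellation between opposite signs is a representative lying in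
its own subgroup, hence 1, and normality excludes this. -/
theorem IsNormal.isChain_tailLetters {w : List (G × ℤˣ)} (hw : IsNormal S w) (g : G) :
    (tailLetters w g).IsChain
      (fun a b => a.2 ∈ HNNExtension.toSubgroup H K a.1 → a.1 = b.1) := by
  induction w with
  | nil => simp [tailLetters]
  | cons p w ih =>
    obtain ⟨hp, hpw, hw⟩ := isNormal_cons.1 hw
    cases w with
    | nil => simp [tailLetters]
    | cons q w =>
      refine List.isChain_cons_cons.2 ⟨fun hmem => ?_, ih hw⟩
      simp only [headEntry, toSubgroup_neg] at hmem
      by_contra hne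
      have hpq : p.2 ≠ q.2 := by simpa using hne
      have hqp : -q.2 = p.2 := by rw [units_eq_neg_of_ne hpq, neg_neg]
      have h1 := S.eq_one (hqp ▸ (isNormal_cons.1 hw).1) hmem
      exact hpq (hpw q (by simp) h1)

/-- The reduced word obtained from a normal form by left multiplication by `a ∈ G`. -/
def IsNormal.reducedWord {w : List (G × ℤˣ)} (hw : IsNormal S w) (a g : G) :
    HNNExtension.NormalWord.ReducedWord G H K :=
  ⟨a * headEntry w g, tailLetters w g, hw.isChain_tailLetters g⟩

theorem IsNormal.prod_reducedWord {w : List (G × ℤˣ)} (hw : IsNormal S w) (a g : G) :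
    (hw.reducedWord a g).prod θ = HNNExtension.of a * wordProd θ w g := by
  simp only [HNNExtension.NormalWord.ReducedWord.prod, IsNormal.reducedWord, map_mul, mul_assoc,
    of_headEntry_mul_prod]

theorem IsNormal.of_mul_wordProd_ne {p : G × ℤˣ} {w : List (G × ℤˣ)} (hw : IsNormal S (p :: w))
    (a g b : G) : HNNExtension.of a * wordProd θ (p :: w) g ≠ HNNExtension.of b := by
  intro h
  have := HNNExtension.ReducedWord.toList_eq_nil_of_mem_of_range θ (hw.reducedWord a g)
    ⟨b, by rw [hw.prod_reducedWord, h]⟩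
  simp [IsNormal.reducedWord, tailLetters] at this

/-- The part of uniqueness that half-trees need: by Britton's lemma the product determines the first
sign and the coset of the first entry. -/
theorem IsNormal.head_eq {p q : G × ℤˣ} {w w' : List (G × ℤˣ)} (hw : IsNormal S (p :: w))
    (hw' : IsNormal S (q :: w')) {a g g' : G}
    (h : HNNExtension.of a * wordProd θ (p :: w) g = wordProd θ (q :: w') g') :
    p.2 = q.2 ∧ (a * p.1)⁻¹ * q.1 ∈ assocSubgroup H K (-p.2) := by
  have := HNNExtension.ReducedWord.map_fst_eq_and_of_prod_eq θ (w₁ := hw.reducedWord a g)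
    (w₂ := hw'.reducedWord 1 g') (by simp [IsNormal.prod_reducedWord, h])
  simpa [IsNormal.reducedWord, tailLetters, headEntry, ← toSubgroup_neg] using
    And.imp (fun h => (List.cons.inj h).1) id this

end NormalForm

/-! ### Half-trees -/

section HalfTree

variable {G : Type*} [Group G] {H K : Subgroup G} {θ : H ≃* K} {S : LeftReps H K}

/-- Prepending τ^ε to a normal form either cancels a leading τ^{-ε} or yields a normal form starting
with τ^ε. This makes complements of half-trees half-trees. -/
theorem stable_mul_mem_daggerSet {ε : ℤˣ} {y : HNNExtension G H K θ} :
    stable θ ^ (ε : ℤ) * y ∈ daggerSet θ S ε ↔ y ∉ daggerSet θ S (-ε) := by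
  constructor
  · rintro ⟨v, a, hv, hva⟩ ⟨w, g, hw, rfl⟩
    have hw' := isNormal_cons.1 hw
    rw [wordProd_cons, stable_zpow_neg, map_one, one_mul, mul_inv_cancel_left] at hva
    cases w with
    | nil => exact hv.of_mul_wordProd_ne 1 a g (by simpa using hva.symm)
    | cons q w =>
      obtain ⟨h1, h2⟩ := hv.head_eq hw'.2.2 (a := 1) (by simpa using hva.symm)
      simp only [mul_one, inv_one, one_mul] at h1 h2
      have := hw'.2.1 q (by simp) (S.eq_one (h1 ▸ (isNormal_cons.1 hw'.2.2).1) h2)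
      exact neg_units_ne_self ε (this.trans h1.symm)
  · intro hy
    obtain ⟨w, g, hw, rfl⟩ := exists_isNormal S y
    refine ⟨w, g, isNormal_cons.2 ⟨S.one_mem _, fun q hq hq1 => ?_, hw⟩, by simp [wordProd_cons]⟩
    by_contra hne
    refine hy ?_
    cases w with
    | nil => simp at hq
    | cons p w =>
      obtain rfl : p = q := by simpa using hq
      obtain ⟨a, δ⟩ := p
      obtain rfl : a = 1 := hq1
      obtain rfl := units_eq_neg_of_ne hne
      exact ⟨w, g, hw, rfl⟩

theorem eq_and_mem_of_mem_daggerSet {ε δ : ℤˣ} {g : G} {x : HNNExtension G H K θ}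
    (hx : x ∈ daggerSet θ S ε) (hgx : HNNExtension.of g * x ∈ daggerSet θ S δ) :
    ε = δ ∧ g ∈ assocSubgroup H K (-ε) := by
  obtain ⟨w, a, hw, rfl⟩ := hx
  obtain ⟨v, b, hv, hvb⟩ := hgx
  simpa using hw.head_eq hv hvb

/-- The new first entry represents the coset of g modulo H_{-ε}, so it is still 1. -/
theorem of_mul_mem_daggerSet {ε : ℤˣ} {g : G} {x : HNNExtension G H K θ}
    (hg : g ∈ assocSubgroup H K (-ε)) (hx : x ∈ daggerSet θ S ε) :
    HNNExtension.of g * x ∈ daggerSet θ S ε := by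
  obtain ⟨w, a, hw, rfl⟩ := hx
  obtain ⟨v, b, hv, hvb, hhead⟩ := hw.exists_of_mul (θ := θ) g a
  cases v with
  | nil => exact absurd hvb.symm (by simpa using hw.of_mul_wordProd_ne (θ := θ) g a b)
  | cons q v =>
    obtain ⟨c, δ⟩ := q
    have h : δ = ε ∧ c⁻¹ * g ∈ assocSubgroup H K (-ε) := by simpa using hhead
    obtain ⟨rfl, hc⟩ := h
    rw [Subgroup.mul_mem_cancel_right _ hg, inv_mem_iff] at hc
    obtain rfl : c = 1 := S.eq_one (isNormal_cons.1 hv).1 hc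
    exact ⟨v, b, hv, hvb.symm⟩

theorem mul_of_mem_daggerSet {ε : ℤˣ} {x : HNNExtension G H K θ} (g : G) :
    x * HNNExtension.of g ∈ daggerSet θ S ε ↔ x ∈ daggerSet θ S ε := by
  have key : ∀ (x : HNNExtension G H K θ) (g : G), x ∈ daggerSet θ S ε →
      x * HNNExtension.of g ∈ daggerSet θ S ε := by
    rintro _ g ⟨w, a, hw, rfl⟩
    exact ⟨w, a * g, hw, wordProd_mul_of _ _ _⟩
  exact ⟨fun h => by simpa [mul_assoc, ← map_mul] using key _ g⁻¹ h, key x g⟩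

theorem of_notMem_daggerSet (ε : ℤˣ) (g : G) :
    (HNNExtension.of g : HNNExtension G H K θ) ∉ daggerSet θ S ε := by
  rintro ⟨w, a, hw, h⟩
  exact hw.of_mul_wordProd_ne 1 a g (by simpa using h.symm)

theorem one_notMem_daggerSet (ε : ℤˣ) : (1 : HNNExtension G H K θ) ∉ daggerSet θ S ε := by
  simpa using of_notMem_daggerSet (θ := θ) (S := S) ε 1

variable (θ S) in
/-- The half-tree `x T_ε†`. -/
def halfTree (x : HNNExtension G H K θ) (ε : ℤˣ) : Set (HNNExtension G H K θ) :=
  {y | x⁻¹ * y ∈ daggerSet θ S ε}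

theorem mem_halfTree {x y : HNNExtension G H K θ} {ε : ℤˣ} :
    y ∈ halfTree θ S x ε ↔ x⁻¹ * y ∈ daggerSet θ S ε := Iff.rfl

theorem mul_mem_halfTree_mul {x y z : HNNExtension G H K θ} {ε : ℤˣ} :
    z * y ∈ halfTree θ S (z * x) ε ↔ y ∈ halfTree θ S x ε := by
  simp [mem_halfTree, mul_assoc]

theorem mem_halfTree_mul {x y z : HNNExtension G H K θ} {ε : ℤˣ} :
    y ∈ halfTree θ S (z * x) ε ↔ z⁻¹ * y ∈ halfTree θ S x ε := by
  simp [mem_halfTree, mul_assoc]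

theorem mul_of_mem_halfTree {x y : HNNExtension G H K θ} {ε : ℤˣ} (g : G) :
    y * HNNExtension.of g ∈ halfTree θ S x ε ↔ y ∈ halfTree θ S x ε := by
  rw [mem_halfTree, mem_halfTree, ← mul_assoc, mul_of_mem_daggerSet]

theorem halfTree_one (ε : ℤˣ) : halfTree θ S 1 ε = daggerSet θ S ε := by
  ext; simp [mem_halfTree]

theorem halfTree_mul_stable_neg (x : HNNExtension G H K θ) (ε : ℤˣ) :
    halfTree θ S (x * stable θ ^ (ε : ℤ)) (-ε) = (halfTree θ S x ε)ᶜ := by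
  ext y
  rw [Set.mem_compl_iff, mem_halfTree, mem_halfTree, iff_not_comm, mul_inv_rev, mul_assoc,
    ← stable_mul_mem_daggerSet, mul_inv_cancel_left]

theorem stable_mem_daggerSet (ε : ℤˣ) : stable θ ^ (ε : ℤ) ∈ daggerSet θ S ε := by
  simpa using stable_mul_mem_daggerSet.2 (one_notMem_daggerSet (θ := θ) (S := S) (-ε))

theorem mul_stable_mem_halfTree (x : HNNExtension G H K θ) (ε : ℤˣ) :
    x * stable θ ^ (ε : ℤ) ∈ halfTree θ S x ε := by
  simpa [mem_halfTree] using stable_mem_daggerSet ε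

/-- Two half-trees at the base vertex with a common point coincide. -/
theorem eq_of_mem_halfTree_of {g g' : G} {ε δ : ℤˣ} {x : HNNExtension G H K θ}
    (h : x ∈ halfTree θ S (HNNExtension.of g) ε) (h' : x ∈ halfTree θ S (HNNExtension.of g') δ) :
    ε = δ ∧ g'⁻¹ * g ∈ assocSubgroup H K (-ε) :=
  eq_and_mem_of_mem_daggerSet h (by simpa [mul_assoc, mem_halfTree] using h')

theorem halfTree_of_eq {g g' : G} {ε δ : ℤˣ} {x : HNNExtension G H K θ}
    (h : x ∈ halfTree θ S (HNNExtension.of g) ε) (h' : x ∈ halfTree θ S (HNNExtension.of g') δ) :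
    halfTree θ S (HNNExtension.of g) ε = halfTree θ S (HNNExtension.of g') δ := by
  obtain ⟨rfl, hg⟩ := eq_of_mem_halfTree_of h h'
  ext y
  constructor <;> intro hy
  · simpa [mem_halfTree, mul_assoc] using of_mul_mem_daggerSet hg hy
  · simpa [mem_halfTree, mul_assoc] using of_mul_mem_daggerSet (inv_mem hg) hy

theorem exists_mem_halfTree_of (S : LeftReps H K) {x : HNNExtension G H K θ}
    (hx : x ∉ baseG θ) : ∃ (g : G) (ε : ℤˣ), x ∈ halfTree θ S (HNNExtension.of g) ε := by
  obtain ⟨w, a, hw, rfl⟩ := exists_isNormal S x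
  cases w with
  | nil => exact absurd ⟨a, by simp⟩ hx
  | cons p w =>
    exact ⟨p.1, p.2, w, a, isNormal_cons.2 ⟨S.one_mem _, (isNormal_cons.1 hw).2⟩,
      by simp [wordProd_cons]⟩

end HalfTree

/-! ### Directions in the tree and inclusions of half-trees -/

section HalfTree

variable {G : Type*} [Group G] {H K : Subgroup G} {θ : H ≃* K} {S : LeftReps H K}

/-- Induction on the length of the normal form; the condition x ∉ T_{-ε}† says that τ^ε does not
cancel against x. -/
theorem halfTree_induction (S : LeftReps H K) {P : HNNExtension G H K θ → Prop}
    (of : ∀ g, P (HNNExtension.of g))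
    (mul : ∀ (g : G) (ε : ℤˣ) (x), x ∉ daggerSet θ S (-ε) → P x →
      P (HNNExtension.of g * (stable θ ^ (ε : ℤ) * x))) (x : HNNExtension G H K θ) : P x := by
  obtain ⟨w, a, hw, rfl⟩ := exists_isNormal S x
  induction w with
  | nil => simpa using of a
  | cons p w ih =>
    have hw' := isNormal_cons.1 hw
    rw [wordProd_cons]
    refine mul _ _ _ (stable_mul_mem_daggerSet.1 ⟨w, a, ?_, by simp [wordProd_cons]⟩) (ih hw'.2.2)
    exact isNormal_cons.2 ⟨S.one_mem _, hw'.2⟩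

theorem of_notMem_halfTree_of (g g' : G) (ε : ℤˣ) :
    HNNExtension.of g' ∉ halfTree θ S (HNNExtension.of g) ε := by
  rw [mem_halfTree, ← map_inv, ← map_mul]
  exact of_notMem_daggerSet _ _

theorem one_notMem_halfTree_of (g : G) (ε : ℤˣ) :
    1 ∉ halfTree θ S (HNNExtension.of g) ε := by
  simpa using of_notMem_halfTree_of (θ := θ) (S := S) g 1 ε

theorem of_mul_stable_mul_mem_halfTree {g : G} {ε : ℤˣ} {x : HNNExtension G H K θ} :
    HNNExtension.of g * (stable θ ^ (ε : ℤ) * x) ∈ halfTree θ S (HNNExtension.of g) ε ↔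
      x ∉ daggerSet θ S (-ε) := by
  rw [mem_halfTree, inv_mul_cancel_left, stable_mul_mem_daggerSet]

theorem halfTree_of_one (ε : ℤˣ) :
    halfTree θ S (HNNExtension.of 1) ε = daggerSet θ S ε := by
  rw [map_one, halfTree_one]

/-- Seen from a vertex `x` of a half-tree at the base vertex, all points outside this half-tree
lie in the same direction. -/
theorem exists_common_halfTree (x : HNNExtension G H K θ) {g : G} {ε : ℤˣ}
    (hx : x ∈ halfTree θ S (HNNExtension.of g) ε) {z z' : HNNExtension G H K θ}
    (hz : z ∉ halfTree θ S (HNNExtension.of g) ε) (hz' : z' ∉ halfTree θ S (HNNExtension.of g) ε) :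
    ∃ (g' : G) (δ : ℤˣ), x⁻¹ * z ∈ halfTree θ S (HNNExtension.of g') δ ∧
      x⁻¹ * z' ∈ halfTree θ S (HNNExtension.of g') δ := by
  induction x using halfTree_induction S generalizing g ε z z' with
  | of a => exact absurd hx (of_notMem_halfTree_of _ _ _)
  | mul a η x hxη ih =>
    rw [halfTree_of_eq hx (of_mul_stable_mul_mem_halfTree.2 hxη)] at hz hz'
    have reduce : ∀ z, z ∉ halfTree θ S (HNNExtension.of a) η →
        (HNNExtension.of a * stable θ ^ (η : ℤ))⁻¹ * z ∈ daggerSet θ S (-η) := by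
      intro z hz
      by_contra h
      exact hz (by simpa [mul_assoc] using of_mul_stable_mul_mem_halfTree (g := a).2 h)
    have hy := reduce z hz
    have hy' := reduce z' hz'
    rw [← mul_assoc, mul_inv_rev, mul_assoc, mul_assoc]
    -- After translation both points lie in T_{-η}†. If x ∈ G, this direction, moved by x⁻¹, is the
    -- common one. Otherwise x lies in a different direction at the base vertex and the induction
    -- hypothesis applies.
    by_cases hxG : x ∈ baseG θ
    · obtain ⟨b, rfl⟩ := hxG
      exact ⟨b⁻¹, -η, by simpa [mem_halfTree] using hy, by simpa [mem_halfTree] using hy'⟩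
    · obtain ⟨b, δ, hb⟩ := exists_mem_halfTree_of S hxG
      have key : ∀ y ∈ daggerSet θ S (-η), y ∉ halfTree θ S (HNNExtension.of b) δ := by
        intro y hy hyb
        rw [← halfTree_of_one] at hy hxη
        exact hxη (halfTree_of_eq hy hyb ▸ hb)
      exact ih hb (key _ hy) (key _ hy')

/-- If z in yT_δ† were outside the half-tree around y, then z and 1 would lie in the same direction
from y, so 1 would lie in yT_δ†. -/
theorem halfTree_subset_halfTree_of {y : HNNExtension G H K θ} {δ ε : ℤˣ} {g : G}
    (hy : y ∈ halfTree θ S (HNNExtension.of g) ε) (h1 : 1 ∉ halfTree θ S y δ) :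
    halfTree θ S y δ ⊆ halfTree θ S (HNNExtension.of g) ε := by
  intro z hz
  by_contra hzg
  obtain ⟨g', δ', h, h'⟩ := exists_common_halfTree y hy hzg (one_notMem_halfTree_of g ε)
  rw [mem_halfTree, ← halfTree_of_one] at hz h1
  exact h1 (halfTree_of_eq h hz ▸ h')

theorem exists_halfTree_subset_halfTree_of {y : HNNExtension G H K θ} {δ : ℤˣ}
    (h1 : 1 ∉ halfTree θ S y δ) :
    ∃ (g : G) (ε : ℤˣ), halfTree θ S y δ ⊆ halfTree θ S (HNNExtension.of g) ε := by
  by_cases hy : y ∈ baseG θ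
  · obtain ⟨g, rfl⟩ := hy
    exact ⟨g, δ, subset_rfl⟩
  · obtain ⟨g, ε, hg⟩ := exists_mem_halfTree_of S hy
    exact ⟨g, ε, halfTree_subset_halfTree_of hg h1⟩

/-- The vertices of x and xτ are adjacent, so the step can leave the half-tree only through its
boundary edge, ending at the base vertex. -/
theorem mul_stable_mem_halfTree_of (x : HNNExtension G H K θ) {g : G} {ε : ℤˣ}
    (hx : x ∈ halfTree θ S (HNNExtension.of g) ε) :
    x * stable θ ∈ halfTree θ S (HNNExtension.of g) ε ∨ ε = -1 ∧ x * stable θ ∈ baseG θ := by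
  induction x using halfTree_induction S generalizing g ε with
  | of a => exact absurd hx (of_notMem_halfTree_of _ _ _)
  | mul a η x hxη ih =>
    have hx' := of_mul_stable_mul_mem_halfTree (g := a).2 hxη
    obtain rfl := (eq_of_mem_halfTree_of hx hx').1
    rw [halfTree_of_eq hx hx', mul_assoc, mul_assoc, of_mul_stable_mul_mem_halfTree]
    refine or_iff_not_imp_left.2 fun hxs => ?_
    rw [not_not] at hxs
    have hxG : x ∈ baseG θ := by
      by_contra hxG
      obtain ⟨b, δ, hb⟩ := exists_mem_halfTree_of S hxG
      rw [← halfTree_of_one] at hxη hxs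
      rcases ih hb with h | ⟨-, c, hc⟩
      · exact hxη (halfTree_of_eq h hxs ▸ hb)
      · exact of_notMem_halfTree_of (θ := θ) (S := S) 1 c _ (hc ▸ hxs)
    obtain ⟨b, rfl⟩ := hxG
    have hb := mul_stable_mem_halfTree (S := S) (HNNExtension.of b : HNNExtension G H K θ) 1
    rw [Units.val_one, zpow_one] at hb
    rw [← halfTree_of_one] at hxs
    obtain ⟨h1, h2⟩ := eq_of_mem_halfTree_of hb hxs
    obtain ⟨b', -, hb'⟩ := of_mul_stable_zpow (θ := θ) h2
    have hη : ε = -1 := by rw [h1, neg_neg]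
    subst hη
    refine ⟨rfl, a * b', ?_⟩
    rw [inv_one, one_mul, Units.val_one, zpow_one] at hb'
    simp [hb']

theorem mul_stable_mem_halfTree_one {x y : HNNExtension G H K θ} (hy : y ∈ halfTree θ S x 1) :
    y * stable θ ∈ halfTree θ S x 1 := by
  rw [mem_halfTree, ← halfTree_of_one] at hy ⊢
  rw [← mul_assoc]
  exact (mul_stable_mem_halfTree_of _ hy).resolve_right (by simp)

theorem exists_halfTree_one_subset (hna : NonAscending θ) (x : HNNExtension G H K θ) (ε : ℤˣ) :
    ∃ y, halfTree θ S y 1 ⊆ halfTree θ S x ε := by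
  obtain ⟨g, hg⟩ := hna.exists_notMem (-1)
  -- At the vertex of xτ^ε the direction back to x is T_{-ε}†. As g ∉ H, the direction gT_1† is a
  -- different one, whatever ε is.
  refine ⟨x * (stable θ ^ (ε : ℤ) * HNNExtension.of g), fun z hz => ?_⟩
  rw [mem_halfTree_mul, mem_halfTree_mul] at hz
  rw [mem_halfTree, ← mul_inv_cancel_left (stable θ ^ (ε : ℤ)) (x⁻¹ * z),
    stable_mul_mem_daggerSet, ← halfTree_of_one]
  intro hz'
  exact hg (by simpa using (eq_of_mem_halfTree_of hz hz').2)

theorem exists_notMem_halfTree_of (hna : NonAscending θ) (p q r : HNNExtension G H K θ) :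
    ∃ (g : G) (δ : ℤˣ), p ∉ halfTree θ S (HNNExtension.of g) δ ∧
      q ∉ halfTree θ S (HNNExtension.of g) δ ∧ r ∉ halfTree θ S (HNNExtension.of g) δ := by
  choose s hs using hna.exists_notMem
  -- Two cosets for each of the two signs give four distinct directions, and three points meet at
  -- most three of them.
  let c : Bool × ℤˣ → G := fun b => if b.1 then s (-b.2) else 1
  by_contra! hcon
  have hall : ∀ b : Bool × ℤˣ, ∃ i : Fin 3,
      ![p, q, r] i ∈ halfTree θ S (HNNExtension.of (c b)) b.2 := by
    intro b
    by_contra! h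
    exact h 2 (hcon (c b) b.2 (h 0) (h 1))
  choose f hf using hall
  obtain ⟨⟨b, δ⟩, ⟨b', δ'⟩, hne, heq⟩ := Fintype.exists_ne_map_eq_of_card_lt f (by decide)
  have h := hf (b, δ)
  rw [heq] at h
  obtain ⟨h1, h2⟩ := eq_of_mem_halfTree_of h (hf (b', δ'))
  obtain rfl : δ = δ' := h1
  cases b <;> cases b' <;> simp_all [c]

/-! ### Quasi-kernels and half-trees moved off themselves -/

theorem mem_quasiKernel {ε : ℤˣ} {k : HNNExtension G H K θ} :
    k ∈ quasiKernel θ S ε ↔ ∀ r ∉ daggerSet θ S ε, r⁻¹ * k * r ∈ baseH θ := by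
  simp only [quasiKernel, Subgroup.mem_iInf, Set.mem_compl_iff]
  refine forall₂_congr fun r _ => ⟨?_, fun h => ⟨_, h, by simp [mul_assoc]⟩⟩
  rintro ⟨h, hh, rfl⟩
  simpa [mul_assoc] using hh

theorem baseH_le_baseG : baseH θ ≤ baseG θ := by
  rintro _ ⟨h, -, rfl⟩
  exact ⟨h, rfl⟩

theorem exists_conj_notMem_baseG (hna : NonAscending θ) (hK : quasiKernel θ S (-1) = ⊥)
    {f : HNNExtension G H K θ} (hf : f ≠ 1) (x : HNNExtension G H K θ) (ε : ℤˣ) :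
    ∃ r ∈ halfTree θ S x ε, r⁻¹ * f * r ∉ baseG θ := by
  obtain ⟨y, hy⟩ := exists_halfTree_one_subset (S := S) hna x ε
  -- The complement of T_{-1}† is carried onto yT_1† by yτ, so f moves some edge rH with r in yT_1†.
  have hk : (y * stable θ)⁻¹ * f * (y * stable θ) ∉ quasiKernel θ S (-1) := by
    rw [hK, Subgroup.mem_bot]
    intro h
    rw [mul_eq_one_iff_eq_inv, mul_eq_left] at h
    exact hf h
  rw [mem_quasiKernel] at hk
  push Not at hk
  obtain ⟨r, hr, hrH⟩ := hk
  have hmem : y * stable θ * r ∈ halfTree θ S y 1 := by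
    rw [mul_assoc, mem_halfTree, inv_mul_cancel_left]
    simpa using stable_mul_mem_daggerSet (ε := 1).2 hr
  -- If f fixes the origin of the moved edge, it moves its other endpoint, which also lies in yT_1†.
  by_cases hG : (y * stable θ * r)⁻¹ * f * (y * stable θ * r) ∈ baseG θ
  · obtain ⟨g, hg⟩ := hG
    refine ⟨_, hy (mul_stable_mem_halfTree_one hmem), ?_⟩
    rintro ⟨g', hg'⟩
    have hgH : g ∉ H := fun hgH => hrH ⟨g, hgH, by rw [hg]; simp [mul_assoc]⟩
    have h1 := mul_stable_mem_halfTree (S := S) (HNNExtension.of g : HNNExtension G H K θ) 1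
    have h2 := mul_stable_mem_halfTree (S := S) (HNNExtension.of 1 : HNNExtension G H K θ) 1
    rw [← mul_of_mem_halfTree g'] at h2
    have h3 : HNNExtension.of 1 * stable θ ^ ((1 : ℤˣ) : ℤ) * HNNExtension.of g' =
        HNNExtension.of g * stable θ ^ ((1 : ℤˣ) : ℤ) := by
      rw [hg', hg]
      simp [mul_assoc]
    rw [h3] at h2
    exact hgH (by simpa [assocSubgroup] using (eq_of_mem_halfTree_of h1 h2).2)
  · exact ⟨_, hy hmem, hG⟩

theorem exists_halfTree_disjoint (hna : NonAscending θ) (hK : quasiKernel θ S (-1) = ⊥)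
    {f : HNNExtension G H K θ} (hf : f ≠ 1) (x : HNNExtension G H K θ) (ε : ℤˣ) :
    ∃ y δ, halfTree θ S y δ ⊆ halfTree θ S x ε ∧
      ∀ z ∈ halfTree θ S y δ, f * z ∉ halfTree θ S y δ := by
  obtain ⟨r, hr, hp⟩ := exists_conj_notMem_baseG hna hK hf x ε
  set p := r⁻¹ * f * r with hpdef
  have hC : ∀ z, z ∉ halfTree θ S x ε →
      r⁻¹ * z ∈ halfTree θ S (r⁻¹ * (x * stable θ ^ (ε : ℤ))) (-ε) := by
    intro z hz
    rw [mul_mem_halfTree_mul, halfTree_mul_stable_neg]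
    exact hz
  have h1 : 1 ∉ halfTree θ S (r⁻¹ * (x * stable θ ^ (ε : ℤ))) (-ε) := by
    rw [mem_halfTree_mul, halfTree_mul_stable_neg]
    simpa using hr
  obtain ⟨g₀, ε₀, hg₀⟩ := exists_halfTree_subset_halfTree_of h1
  -- Avoiding r⁻¹x keeps the new half-tree inside the old one. Avoiding p⁻¹ puts its translate by p
  -- inside the direction of p, and avoiding p makes that direction a different one.
  obtain ⟨s, δ, hs, hs', hs''⟩ := exists_notMem_halfTree_of (S := S) hna p p⁻¹ (r⁻¹ * x)
  refine ⟨r * HNNExtension.of s, δ, fun z hz => ?_, fun z hz hfz => ?_⟩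
  · rw [mem_halfTree_mul] at hz
    by_contra hzx
    have hx : x ∉ halfTree θ S x ε := by
      rw [mem_halfTree, inv_mul_cancel]
      exact one_notMem_daggerSet _
    exact hs'' (halfTree_of_eq (hg₀ (hC z hzx)) hz ▸ hg₀ (hC x hx))
  · rw [mem_halfTree_mul] at hz hfz
    obtain ⟨g, η, hg⟩ := exists_mem_halfTree_of S hp
    have hsub : halfTree θ S (p * HNNExtension.of s) δ ⊆ halfTree θ S (HNNExtension.of g) η :=
      halfTree_subset_halfTree_of ((mul_of_mem_halfTree s).2 hg)
        (by rwa [mem_halfTree_mul, mul_one])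
    have hpz : p * (r⁻¹ * z) = r⁻¹ * (f * z) := by simp [hpdef, mul_assoc]
    have := hsub (mul_mem_halfTree_mul.2 hz)
    rw [hpz] at this
    exact hs (halfTree_of_eq this hfz ▸ hg)

theorem exists_halfTree_disjoint_of_finite (hna : NonAscending θ)
    (hK : quasiKernel θ S (-1) = ⊥) {F : Set (HNNExtension G H K θ)} (hF : F.Finite)
    (h1 : 1 ∉ F) :
    ∃ y δ, ∀ f ∈ F, ∀ z ∈ halfTree θ S y δ, f * z ∉ halfTree θ S y δ := by
  induction F, hF using Set.Finite.induction_on with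
  | empty => exact ⟨1, 1, by simp⟩
  | @insert a F _ _ ih =>
    rw [Set.mem_insert_iff, not_or] at h1
    obtain ⟨x, ε, hx⟩ := ih h1.2
    obtain ⟨y, δ, hyx, hy⟩ := exists_halfTree_disjoint hna hK (Ne.symm h1.1) x ε
    refine ⟨y, δ, ?_⟩
    rintro f (rfl | hf) z hz
    · exact hy z hz
    · exact fun hfz => hx f hf z (hyx hz) (hyx hfz)

/-- With T = T_δ†, α = τ^δ and g ∉ H_{-δ}, the set gT misses T while α^m gT ⊆ T for m ≥ 1; hence the
sets α^{j+1}gT are disjoint. -/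
theorem exists_pairwise_disjoint_translates (hna : NonAscending θ) (S : LeftReps H K) (δ : ℤˣ) :
    ∃ a : ℕ → HNNExtension G H K θ, ∀ j k, j ≠ k → ∀ z ∈ daggerSet θ S δ,
      ∀ z' ∈ daggerSet θ S δ, a j * z ≠ a k * z' := by
  obtain ⟨g, hg⟩ := hna.exists_notMem (-δ)
  set α : HNNExtension G H K θ := stable θ ^ (δ : ℤ) with hα
  have hβ : ∀ (b : G), ∀ z ∈ daggerSet θ S δ, α * (HNNExtension.of b * z) ∈ daggerSet θ S δ := by
    intro b z hz
    refine stable_mul_mem_daggerSet.2 fun h => ?_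
    exact neg_units_ne_self δ (eq_and_mem_of_mem_daggerSet hz h).1.symm
  have hpow : ∀ (n : ℕ), ∀ z ∈ daggerSet θ S δ, α ^ n * z ∈ daggerSet θ S δ := by
    intro n
    induction n with
    | zero => simp
    | succ n ih =>
      intro z hz
      rw [pow_succ, mul_assoc]
      exact ih _ (by simpa using hβ 1 z hz)
  have key : ∀ j k : ℕ, j < k → ∀ z ∈ daggerSet θ S δ, ∀ z' ∈ daggerSet θ S δ,
      α ^ j * (α * HNNExtension.of g) * z ≠ α ^ k * (α * HNNExtension.of g) * z' := by
    intro j k hjk z hz z' hz' h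
    obtain ⟨n, rfl⟩ := Nat.exists_eq_add_of_lt hjk
    rw [add_assoc, pow_add, add_comm n, pow_add, pow_one] at h
    simp only [mul_assoc, mul_right_inj] at h
    refine hg (eq_and_mem_of_mem_daggerSet hz (h ▸ hpow n _ (hβ g z' hz'))).2
  refine ⟨fun j => α ^ j * (α * HNNExtension.of g), fun j k hjk z hz z' hz' h => ?_⟩
  rcases lt_or_gt_of_ne hjk with hlt | hlt
  · exact key j k hlt z hz z' hz' h
  · exact key k j hlt z' hz' z hz h.symm

theorem isPowersGroup_of_quasiKernel_eq_bot (hna : NonAscending θ)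
    (hK : quasiKernel θ S (-1) = ⊥) : IsPowersGroup (HNNExtension G H K θ) := by
  refine ⟨⟨1, stable θ ^ ((1 : ℤˣ) : ℤ), fun h => ?_⟩, fun F hF h1 N _ => ?_⟩
  · exact one_notMem_daggerSet (S := S) 1 (h ▸ stable_mem_daggerSet 1)
  · obtain ⟨y, δ, hy⟩ := exists_halfTree_disjoint_of_finite hna hK hF h1
    obtain ⟨a, ha⟩ := exists_pairwise_disjoint_translates hna S (-δ)
    refine ⟨halfTree θ S y δ, (halfTree θ S y δ)ᶜ,
      fun j => a j * (y * stable θ ^ (δ : ℤ))⁻¹, Set.union_compl_self _, disjoint_compl_right,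
      fun f hf => ?_, fun j k hjk => ?_⟩
    · rw [Set.disjoint_left]
      rintro _ ⟨z, hz, rfl⟩
      exact hy f hf z hz
    · rw [Set.disjoint_left]
      rintro _ ⟨z, hz, rfl⟩ ⟨z', hz', h⟩
      rw [← halfTree_mul_stable_neg] at hz hz'
      exact ha j k (fun h => hjk (Fin.ext h)) _ hz _ hz' (by simpa only [mul_assoc] using h.symm)

theorem finiteConjAvoids_baseG (hna : NonAscending θ) (hK : quasiKernel θ S (-1) = ⊥) :
    FiniteConjAvoids Set.univ (baseG θ : Set (HNNExtension G H K θ)) := by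
  intro F hF hF1
  obtain ⟨y, δ, hy⟩ := exists_halfTree_disjoint_of_finite hna hK hF (fun h => (hF1 h).2 rfl)
  set x := y * stable θ ^ (δ : ℤ) with hx
  have hxy : x ∈ halfTree θ S y δ := mul_stable_mem_halfTree y δ
  refine ⟨x⁻¹, Set.eq_empty_of_forall_notMem ?_⟩
  rintro _ ⟨⟨f, hf, rfl⟩, g, hg⟩
  refine hy f hf x hxy ?_
  have : f * x = x * HNNExtension.of g := by simp [hg, mul_assoc]
  rwa [this, mul_of_mem_halfTree]

theorem FiniteConjAvoids.mono {Γ : Type*} [Group Γ] {X X' Y Y' : Set Γ}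
    (h : FiniteConjAvoids X Y) (hX : X' ⊆ X) (hY : Y' ⊆ Y) : FiniteConjAvoids X' Y' := by
  intro F hF hFX
  obtain ⟨g, hg⟩ := h F hF (hFX.trans (Set.sdiff_subset_sdiff_left hX))
  exact ⟨g, Set.subset_eq_empty (Set.inter_subset_inter_right _ hY) hg⟩

theorem quasiKernel_eq_bot_of_finiteConjAvoids (hna : NonAscending θ)
    (h : FiniteConjAvoids (baseH θ : Set (HNNExtension G H K θ)) (baseH θ)) (ε : ℤˣ) :
    quasiKernel θ S ε = ⊥ := by
  rw [Subgroup.eq_bot_iff_forall]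
  intro k hk
  by_contra hk1
  rw [mem_quasiKernel] at hk
  obtain ⟨g, hg⟩ := hna.exists_notMem (-ε)
  have hkg : ∀ r : HNNExtension G H K θ, (HNNExtension.of g)⁻¹ * r ∉ daggerSet θ S ε →
      r⁻¹ * (HNNExtension.of g * k * (HNNExtension.of g)⁻¹) * r ∈ baseH θ := by
    intro r hr
    simpa [mul_assoc] using hk _ hr
  obtain ⟨x, hx⟩ := h {k, HNNExtension.of g * k * (HNNExtension.of g)⁻¹} (by simp) (by
    rintro _ (rfl | rfl)
    · exact ⟨by simpa using hk 1 (one_notMem_daggerSet _), hk1⟩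
    · refine ⟨by simpa using hkg 1 (by simpa using of_notMem_daggerSet ε g⁻¹), ?_⟩
      simpa using hk1)
  rw [Set.eq_empty_iff_forall_notMem] at hx
  -- T_ε† and gT_ε† are disjoint, so x⁻¹ lies outside one of them, and the corresponding element is
  -- conjugated into H.
  by_cases hxT : x⁻¹ ∈ daggerSet θ S ε
  · refine hx _ ⟨⟨_, Or.inr rfl, rfl⟩, ?_⟩
    simpa using hkg x⁻¹ fun h =>
      hg (by simpa using (eq_and_mem_of_mem_daggerSet (g := g⁻¹) hxT (by simpa using h)).2)
  · exact hx _ ⟨⟨_, Or.inl rfl, rfl⟩, by simpa using hk x⁻¹ hxT⟩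

/-- The complement of T_ε† is τ^εT_{-ε}†; with g ∉ H_ε, the element gτ^{-ε} carries it to gT_{-ε}†,
outside T_{-ε}†. -/
theorem exists_conj_mem_quasiKernel (hna : NonAscending θ) (S : LeftReps H K) (ε : ℤˣ) :
    ∃ c : HNNExtension G H K θ, ∀ k ∈ quasiKernel θ S (-ε), c * k * c⁻¹ ∈ quasiKernel θ S ε := by
  obtain ⟨g, hg⟩ := hna.exists_notMem ε
  refine ⟨(HNNExtension.of g * (stable θ ^ (ε : ℤ))⁻¹)⁻¹, fun k hk => ?_⟩
  rw [mem_quasiKernel] at hk ⊢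
  intro r hr
  have hr' : (stable θ ^ (ε : ℤ))⁻¹ * r ∈ daggerSet θ S (-ε) := by
    rw [← mul_inv_cancel_left (stable θ ^ (ε : ℤ)) r, stable_mul_mem_daggerSet, not_not] at hr
    exact hr
  have := hk (HNNExtension.of g * ((stable θ ^ (ε : ℤ))⁻¹ * r)) fun h =>
    hg (by simpa using (eq_and_mem_of_mem_daggerSet hr' h).2)
  simpa [mul_assoc] using this

theorem quasiKernel_eq_bot_of_neg (hna : NonAscending θ) {ε : ℤˣ}
    (h : quasiKernel θ S ε = ⊥) : quasiKernel θ S (-ε) = ⊥ := by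
  obtain ⟨c, hc⟩ := exists_conj_mem_quasiKernel hna S ε
  rw [Subgroup.eq_bot_iff_forall]
  intro k hk
  simpa [h] using hc k hk

theorem quasiKernel_eq_bot_of_exists (hna : NonAscending θ)
    (h : ∃ ε, quasiKernel θ S ε = ⊥) (δ : ℤˣ) : quasiKernel θ S δ = ⊥ := by
  obtain ⟨ε, hε⟩ := h
  by_cases heq : ε = δ
  · exact heq ▸ hε
  · rw [units_eq_neg_of_ne heq]
    exact quasiKernel_eq_bot_of_neg hna hε

theorem normalClosure_quasiKernel_neg_le (hna : NonAscending θ) (S : LeftReps H K) (ε : ℤˣ) :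
    Subgroup.normalClosure (quasiKernel θ S (-ε) : Set (HNNExtension G H K θ)) ≤
      Subgroup.normalClosure (quasiKernel θ S ε : Set (HNNExtension G H K θ)) := by
  obtain ⟨c, hc⟩ := exists_conj_mem_quasiKernel hna S ε
  refine Subgroup.normalClosure_le_normal fun k hk => ?_
  simpa [mul_assoc] using Subgroup.normalClosure_normal.conj_mem _
    (Subgroup.subset_normalClosure (hc k hk)) c⁻¹

theorem normalClosure_quasiKernel (hna : NonAscending θ) (S : LeftReps H K) (ε : ℤˣ) :
    Subgroup.normalClosure (quasiKernel θ S ε : Set (HNNExtension G H K θ)) = interior θ S := by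
  rcases Int.units_eq_one_or ε with rfl | rfl
  · refine le_antisymm ?_ (normalClosure_quasiKernel_neg_le hna S 1)
    simpa [interior] using normalClosure_quasiKernel_neg_le hna S (-1)
  · rfl

theorem interior_eq_bot_iff : interior θ S = ⊥ ↔ quasiKernel θ S (-1) = ⊥ := by
  refine ⟨fun h => ?_, fun h => ?_⟩
  · rw [eq_bot_iff, ← h]
    exact fun k hk => Subgroup.subset_normalClosure hk
  · rw [interior, h, eq_bot_iff]
    exact Subgroup.normalClosure_le_normal (by simp)

end HalfTree

/-! ### Powers' norm estimate on ℓ²(Γ) -/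

section CStar

variable {Γ : Type*}

theorem ell2_norm_sq (ξ : ell2 Γ) : ‖ξ‖ ^ 2 = ∑' h, ‖(ξ : Γ → ℂ) h‖ ^ 2 := by
  simpa using lp.norm_rpow_eq_tsum (p := 2) (by norm_num) ξ

theorem ell2_summable (ξ : ell2 Γ) : Summable fun h => ‖(ξ : Γ → ℂ) h‖ ^ 2 := by
  simpa using (memℓp_gen_iff (p := 2) (by norm_num)).1 (lp.memℓp ξ)

theorem norm_indicator_sq_le (D : Set Γ) (f : Γ → ℂ) (h : Γ) :
    ‖D.indicator f h‖ ^ 2 ≤ ‖f h‖ ^ 2 := by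
  gcongr
  exact norm_indicator_le_norm_self f h

/-- The orthogonal projection of `ℓ²(Γ)` onto `ℓ²(D)`. -/
noncomputable def restrictTo (D : Set Γ) (ξ : ell2 Γ) : ell2 Γ :=
  ⟨D.indicator ξ, (memℓp_gen_iff (by norm_num)).2 (by
    simpa using (ell2_summable ξ).of_nonneg_of_le (fun _ => by positivity)
      (norm_indicator_sq_le D ξ))⟩

theorem restrictTo_apply (D : Set Γ) (ξ : ell2 Γ) (h : Γ) :
    (restrictTo D ξ : Γ → ℂ) h = D.indicator ξ h := rfl

theorem restrictTo_add_compl (D : Set Γ) (ξ : ell2 Γ) :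
    restrictTo D ξ + restrictTo Dᶜ ξ = ξ := by
  ext h
  exact congrFun (Set.indicator_self_add_compl D (ξ : Γ → ℂ)) h

theorem norm_restrictTo_le (D : Set Γ) (ξ : ell2 Γ) : ‖restrictTo D ξ‖ ≤ ‖ξ‖ := by
  refine le_of_sq_le_sq ?_ (by positivity)
  rw [ell2_norm_sq, ell2_norm_sq]
  exact (ell2_summable _).tsum_le_tsum (norm_indicator_sq_le D ξ) (ell2_summable ξ)

theorem norm_sum_sq_of_disjoint {ι : Type*} (s : Finset ι) (D : ι → Set Γ)
    (hD : Pairwise fun j k => Disjoint (D j) (D k)) (v : ι → ell2 Γ)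
    (hv : ∀ j, ∀ h ∉ D j, (v j : Γ → ℂ) h = 0) : ‖∑ j ∈ s, v j‖ ^ 2 = ∑ j ∈ s, ‖v j‖ ^ 2 := by
  classical
  induction s using Finset.induction_on with
  | empty => simp
  | insert j s hj ih =>
    rw [Finset.sum_insert hj, Finset.sum_insert hj, ← ih, sq, sq, sq]
    refine norm_add_sq_eq_norm_sq_add_norm_sq_of_inner_eq_zero (𝕜 := ℂ) _ _ ?_
    rw [inner_sum]
    refine Finset.sum_eq_zero fun k hk => ?_
    rw [lp.inner_eq_tsum]
    refine (tsum_congr fun h => ?_).trans tsum_zero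
    by_cases hh : h ∈ D j
    · rw [hv k h (Set.disjoint_left.1 (hD fun hjk : j = k => hj (hjk ▸ hk)) hh), inner_zero_right]
    · rw [hv j h hh, inner_zero_left]

theorem sum_norm_restrictTo_sq_le {ι : Type*} (s : Finset ι) (D : ι → Set Γ)
    (hD : Pairwise fun j k => Disjoint (D j) (D k)) (ξ : ell2 Γ) :
    ∑ j ∈ s, ‖restrictTo (D j) ξ‖ ^ 2 ≤ ‖ξ‖ ^ 2 := by
  rw [← norm_sum_sq_of_disjoint s D hD _ fun j h hh => Set.indicator_of_notMem hh _]
  have : ∑ j ∈ s, restrictTo (D j) ξ = restrictTo (⋃ j ∈ s, D j) ξ := by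
    ext h
    rw [restrictTo_apply, Finset.indicator_biUnion_apply s D fun j _ k _ hjk => hD hjk,
      lp.coeFn_sum, Finset.sum_apply]
    rfl
  rw [this]
  gcongr
  exact norm_restrictTo_le _ _

open Classical in
theorem exists_apply_single_ne_zero {x : ell2 Γ →L[ℂ] ell2 Γ} (hx : x ≠ 0) :
    ∃ g : Γ, x (lp.single 2 g (1 : ℂ)) ≠ 0 := by
  by_contra! h
  refine hx (ContinuousLinearMap.ext fun ξ => ?_)
  have hs := (lp.hasSum_single (by norm_num) ξ).mapL x
  refine hs.unique ?_
  have : ∀ g, x (lp.single 2 g ((ξ : Γ → ℂ) g)) = 0 := by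
    intro g
    have : lp.single 2 g ((ξ : Γ → ℂ) g) = (ξ : Γ → ℂ) g • (lp.single 2 g (1 : ℂ) : ell2 Γ) := by
      rw [← lp.single_smul, smul_eq_mul, mul_one]
    rw [this, map_smul, h, smul_zero]
  simp [this, hasSum_zero]

/-- Compression to `ℓ²(C)` annihilates the operator `b`. -/
def CompressesToZero (b : ell2 Γ →L[ℂ] ell2 Γ) (C : Set Γ) : Prop :=
  ∀ η : ell2 Γ, (∀ h ∉ C, (η : Γ → ℂ) h = 0) → ∀ h ∈ C, (b η : Γ → ℂ) h = 0

/-- Powers' norm estimate. -/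
theorem norm_sum_le_of_compressesToZero {ι : Type*} (s : Finset ι) (D : ι → Set Γ)
    (hD : Pairwise fun j k => Disjoint (D j) (D k)) (b : ι → ell2 Γ →L[ℂ] ell2 Γ) {M : ℝ}
    (hM : 0 ≤ M) (hbM : ∀ j, ‖b j‖ ≤ M) (hb : ∀ j, CompressesToZero (b j) (D j)ᶜ) :
    ‖∑ j ∈ s, b j‖ ≤ 2 * M * √s.card := by
  refine ContinuousLinearMap.opNorm_le_bound _ (by positivity) fun ξ => ?_
  have hbξ : ∀ j (ξ : ell2 Γ), ‖b j ξ‖ ≤ M * ‖ξ‖ := fun j ξ =>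
    ((b j).le_opNorm ξ).trans (mul_le_mul_of_nonneg_right (hbM j) (norm_nonneg _))
  -- With P_j the projection onto ℓ²(D_j), b_jξ = P_j b_jξ + (1 − P_j) b_j P_jξ. The first terms are
  -- orthogonal; the second are summed by Cauchy–Schwarz, using that the P_jξ are orthogonal.
  set u : ι → ell2 Γ := fun j => restrictTo (D j) (b j ξ) with hu
  set v : ι → ell2 Γ := fun j => restrictTo (D j)ᶜ (b j (restrictTo (D j) ξ)) with hv
  have huv : ∀ j, b j ξ = u j + v j := by
    intro j
    have h0 : restrictTo (D j)ᶜ (b j (restrictTo (D j)ᶜ ξ)) = 0 := by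
      ext h
      rw [restrictTo_apply]
      by_cases hh : h ∈ (D j)ᶜ
      · rw [Set.indicator_of_mem hh]
        exact hb j _ (fun k hk => Set.indicator_of_notMem hk _) h hh
      · rw [Set.indicator_of_notMem hh]
        rfl
    have hadd : ∀ η ζ : ell2 Γ, restrictTo (D j)ᶜ (η + ζ) =
        restrictTo (D j)ᶜ η + restrictTo (D j)ᶜ ζ := fun η ζ => by
      ext h
      exact congrFun (Set.indicator_add _ (η : Γ → ℂ) ζ) h
    rw [← restrictTo_add_compl (D j) (b j ξ)]
    congr 1
    conv_lhs => rw [← restrictTo_add_compl (D j) ξ, map_add, hadd, h0, add_zero]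
  have h1 : ‖∑ j ∈ s, u j‖ ≤ M * √s.card * ‖ξ‖ := by
    refine le_of_sq_le_sq ?_
      (mul_nonneg (mul_nonneg hM (Real.sqrt_nonneg _)) (norm_nonneg _))
    rw [norm_sum_sq_of_disjoint s D hD _ fun j h hh => Set.indicator_of_notMem hh _]
    calc ∑ j ∈ s, ‖u j‖ ^ 2 ≤ ∑ j ∈ s, (M * ‖ξ‖) ^ 2 := by
          gcongr with j
          exact (norm_restrictTo_le _ _).trans (hbξ j ξ)
      _ = (M * √s.card * ‖ξ‖) ^ 2 := by
          rw [Finset.sum_const, nsmul_eq_mul, mul_pow, mul_pow, mul_pow,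
            Real.sq_sqrt (Nat.cast_nonneg _)]
          ring
  have h2 : ‖∑ j ∈ s, v j‖ ≤ M * √s.card * ‖ξ‖ := by
    have hsum : ∑ j ∈ s, ‖restrictTo (D j) ξ‖ ≤ √s.card * ‖ξ‖ := by
      refine le_of_sq_le_sq ?_ (mul_nonneg (Real.sqrt_nonneg _) (norm_nonneg _))
      rw [mul_pow, Real.sq_sqrt (Nat.cast_nonneg _)]
      exact sq_sum_le_card_mul_sum_sq.trans
        (mul_le_mul_of_nonneg_left (sum_norm_restrictTo_sq_le s D hD ξ) (Nat.cast_nonneg _))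
    calc ‖∑ j ∈ s, v j‖ ≤ ∑ j ∈ s, ‖v j‖ := norm_sum_le _ _
      _ ≤ ∑ j ∈ s, M * ‖restrictTo (D j) ξ‖ := by
          gcongr with j
          exact (norm_restrictTo_le _ _).trans (hbξ j _)
      _ = M * ∑ j ∈ s, ‖restrictTo (D j) ξ‖ := (Finset.mul_sum _ _ _).symm
      _ ≤ M * (√s.card * ‖ξ‖) := by gcongr
      _ = M * √s.card * ‖ξ‖ := by ring
  have hsum : (∑ j ∈ s, b j) ξ = ∑ j ∈ s, u j + ∑ j ∈ s, v j := by
    rw [sum_apply, ← Finset.sum_add_distrib]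
    exact Finset.sum_congr rfl fun j _ => huv j
  rw [hsum]
  linarith [norm_add_le (∑ j ∈ s, u j) (∑ j ∈ s, v j)]

/-! ### The regular representation and C*-simplicity of Powers groups -/

variable [Group Γ]

theorem leftReg_apply (g : Γ) (ξ : ell2 Γ) (h : Γ) :
    (leftReg g ξ : Γ → ℂ) h = (ξ : Γ → ℂ) (g⁻¹ * h) := rfl

theorem leftReg_one : leftReg (1 : Γ) = 1 := by
  ext ξ h
  simp [leftReg_apply]

theorem leftReg_mul (g h : Γ) : leftReg (g * h) = leftReg g * leftReg h := by
  ext ξ x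
  simp [leftReg_apply, mul_assoc]

theorem star_leftReg (g : Γ) : star (leftReg g) = leftReg g⁻¹ := by
  symm
  rw [ContinuousLinearMap.star_eq_adjoint, ContinuousLinearMap.eq_adjoint_iff]
  intro ξ η
  rw [← (leftRegIsometry g).inner_map_map]
  change inner ℂ (leftReg g (leftReg g⁻¹ ξ)) (leftReg g η) = _
  rw [← mul_apply_eq_comp, ← leftReg_mul, mul_inv_cancel, leftReg_one]
  rfl

theorem norm_leftReg_le (g : Γ) : ‖leftReg g‖ ≤ 1 :=
  (leftRegIsometry g).norm_toContinuousLinearMap_le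

theorem norm_leftReg_conj_le (g : Γ) (b : ell2 Γ →L[ℂ] ell2 Γ) :
    ‖leftReg g * b * leftReg g⁻¹‖ ≤ ‖b‖ := by
  calc ‖leftReg g * b * leftReg g⁻¹‖ ≤ ‖leftReg g‖ * ‖b‖ * ‖leftReg g⁻¹‖ :=
        (norm_mul_le _ _).trans (mul_le_mul_of_nonneg_right (norm_mul_le _ _) (norm_nonneg _))
    _ ≤ 1 * ‖b‖ * 1 := by
        gcongr <;> exact norm_leftReg_le _
    _ = ‖b‖ := by ring

theorem leftReg_mem_reducedCStar (g : Γ) : leftReg g ∈ reducedCStar Γ :=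
  StarSubalgebra.le_topologicalClosure _ (StarAlgebra.subset_adjoin ℂ _ ⟨g, rfl⟩)

theorem exists_finsupp_of_mem_adjoin {b : ell2 Γ →L[ℂ] ell2 Γ}
    (hb : b ∈ StarAlgebra.adjoin ℂ (Set.range (leftReg (Γ := Γ)))) :
    ∃ c : Γ →₀ ℂ, (c.sum fun g a => a • leftReg g) = b := by
  rw [← Finsupp.mem_span_range_iff_exists_finsupp]
  have hstar : star (Set.range (leftReg (Γ := Γ))) = Set.range leftReg := by
    ext x
    rw [Set.mem_star]
    constructor
    · rintro ⟨g, hg⟩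
      exact ⟨g⁻¹, by rw [← star_leftReg, hg, star_star]⟩
    · rintro ⟨g, rfl⟩
      exact ⟨g⁻¹, (star_leftReg g).symm⟩
  let f : Γ →* (ell2 Γ →L[ℂ] ell2 Γ) := ⟨⟨leftReg, leftReg_one⟩, leftReg_mul⟩
  have hf : (Submonoid.closure (Set.range (leftReg (Γ := Γ))) : Set (ell2 Γ →L[ℂ] ell2 Γ)) = Set.range leftReg := by
    exact congrArg SetLike.coe (Submonoid.closure_eq (MonoidHom.mrange f))
  rw [← StarSubalgebra.mem_toSubalgebra, StarAlgebra.adjoin_toSubalgebra, hstar, Set.union_self,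
    ← Subalgebra.mem_toSubmodule, Algebra.adjoin_eq_span, hf] at hb
  exact hb

theorem compressesToZero_sum {ι : Type*} (s : Finset ι) (c : ι → ℂ) (f : ι → Γ) {C : Set Γ}
    (hC : ∀ i ∈ s, Disjoint ((fun x => f i * x) '' C) C) :
    CompressesToZero (∑ i ∈ s, c i • leftReg (f i)) C := by
  intro η hη h hh
  rw [sum_apply, lp.coeFn_sum, Finset.sum_apply]
  refine Finset.sum_eq_zero fun i hi => ?_
  have : (η : Γ → ℂ) ((f i)⁻¹ * h) = 0 := by
    refine hη _ fun hmem => Set.disjoint_left.1 (hC i hi) ⟨_, hmem, ?_⟩ hh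
    simp
  simp [leftReg_apply, this]

theorem CompressesToZero.conj {b : ell2 Γ →L[ℂ] ell2 Γ} {C D : Set Γ}
    (hb : CompressesToZero b C) (g : Γ) (hD : ∀ h, h ∈ D ↔ g⁻¹ * h ∈ C) :
    CompressesToZero (leftReg g * b * leftReg g⁻¹) D := by
  intro η hη h hh
  change (b (leftReg g⁻¹ η) : Γ → ℂ) (g⁻¹ * h) = 0
  refine hb _ (fun k hk => ?_) _ ((hD h).1 hh)
  rw [leftReg_apply, inv_inv]
  exact hη _ fun hmem => hk (by simpa using (hD _).1 hmem)

open Classical in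
theorem norm_apply_single_one_le (b : ell2 Γ →L[ℂ] ell2 Γ) :
    ‖(b (lp.single 2 (1 : Γ) (1 : ℂ)) : Γ → ℂ) 1‖ ≤ ‖b‖ := by
  refine (lp.norm_apply_le_norm two_ne_zero _ _).trans ((b.le_opNorm _).trans_eq ?_)
  rw [lp.norm_single (by norm_num), norm_one, mul_one]

open Classical in
/-- In the reduced `C*`-algebra of a Powers group, averages of conjugates of an element of trace
one come arbitrarily close to `1`. -/
theorem IsPowersGroup.exists_average (hΓ : IsPowersGroup Γ) {a : ell2 Γ →L[ℂ] ell2 Γ}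
    (ha : a ∈ reducedCStar Γ) (htr : (a (lp.single 2 (1 : Γ) (1 : ℂ)) : Γ → ℂ) 1 = 1) :
    ∃ (N : ℕ) (γ : Fin N → Γ), 1 ≤ N ∧
      ‖∑ j, (1 - leftReg (γ j) * a * leftReg (γ j)⁻¹)‖ < N := by
  obtain ⟨b, hb, hab⟩ := Metric.mem_closure_iff.1 ha (1 / 4) (by norm_num)
  rw [dist_eq_norm] at hab
  obtain ⟨c, rfl⟩ := exists_finsupp_of_mem_adjoin hb
  set b := c.sum fun g a => a • leftReg g with hbdef
  set b₀ := ∑ g ∈ c.support.erase 1, c g • leftReg g with hb₀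
  have hbb₀ : b = c 1 • 1 + b₀ := by
    rw [hbdef, hb₀, Finsupp.sum]
    by_cases h1 : 1 ∈ c.support
    · rw [← Finset.add_sum_erase _ _ h1, leftReg_one]
    · rw [Finset.erase_eq_of_notMem h1, Finsupp.notMem_support_iff.1 h1, zero_smul, zero_add]
  -- The matrix coefficient at δ₁ reads off the coefficient of 1, which is 1 for a and c 1 for b.
  have hc1 : ‖1 - c 1‖ < 1 / 4 := by
    refine lt_of_le_of_lt ?_ hab
    have h0 : (b₀ (lp.single 2 (1 : Γ) (1 : ℂ)) : Γ → ℂ) 1 = 0 := by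
      rw [hb₀, sum_apply, lp.coeFn_sum, Finset.sum_apply]
      refine Finset.sum_eq_zero fun g hg => ?_
      have : g⁻¹ ≠ 1 := inv_ne_one.2 (Finset.ne_of_mem_erase hg)
      simp [leftReg_apply, lp.single_apply, this]
    have := norm_apply_single_one_le (a - b)
    rw [sub_apply, lp.coeFn_sub, Pi.sub_apply, htr, hbb₀] at this
    have hb1 : ((c 1 • (1 : ell2 Γ →L[ℂ] ell2 Γ) + b₀) (lp.single 2 (1 : Γ) (1 : ℂ)) : Γ → ℂ) 1 =
        c 1 := by
      change c 1 * (lp.single 2 (1 : Γ) (1 : ℂ) : Γ → ℂ) 1 +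
        (b₀ (lp.single 2 (1 : Γ) (1 : ℂ)) : Γ → ℂ) 1 = _
      rw [h0, lp.single_apply, Pi.single_eq_same, mul_one, add_zero]
    rwa [hb1, ← hbb₀] at this
  -- For N = n² conjugates the estimate bounds the b₀ part by 2‖b₀‖n < N/2; the two errors of size
  -- 1/4 add at most N/2.
  obtain ⟨n, hn⟩ := exists_nat_ge (8 * ‖b₀‖ + 1)
  have hn1 : 1 ≤ n := by
    have : (1 : ℝ) ≤ n := by linarith [norm_nonneg b₀]
    exact_mod_cast this
  have hN1 : 1 ≤ n ^ 2 := Nat.one_le_pow _ _ hn1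
  obtain ⟨C, D, γ, hCD, hCD', hF, hγ⟩ := hΓ.2 (c.support.erase 1 : Finset Γ)
    (Finset.finite_toSet _) (by simp) (n ^ 2) hN1
  refine ⟨n ^ 2, γ, hN1, ?_⟩
  have hDC : ∀ x, x ∉ D ↔ x ∈ C := fun x =>
    ⟨fun hx => ((Set.ext_iff.1 hCD x).2 trivial).resolve_right hx,
      fun hx hx' => Set.disjoint_left.1 hCD' hx hx'⟩
  have hest := norm_sum_le_of_compressesToZero Finset.univ
    (fun j => (fun x => γ j * x) '' D) (fun j k hjk => hγ j k hjk)
    (fun j => leftReg (γ j) * b₀ * leftReg (γ j)⁻¹) (norm_nonneg b₀)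
    (fun j => norm_leftReg_conj_le _ _)
    (fun j => (compressesToZero_sum _ _ _ hF).conj (γ j) fun h => by
      rw [Set.mem_compl_iff, ← hDC, Set.image_mul_left]
      rfl)
  have hdecomp : ∀ j, 1 - leftReg (γ j) * a * leftReg (γ j)⁻¹ =
      (1 - c 1) • (1 : ell2 Γ →L[ℂ] ell2 Γ) - leftReg (γ j) * (a - b) * leftReg (γ j)⁻¹ -
        leftReg (γ j) * b₀ * leftReg (γ j)⁻¹ := by
    intro j
    have h1 : leftReg (γ j) * leftReg (γ j)⁻¹ = 1 := by
      rw [← leftReg_mul, mul_inv_cancel, leftReg_one]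
    rw [hbb₀]
    simp only [mul_sub, sub_mul, mul_add, add_mul, mul_smul_comm, smul_mul_assoc, mul_one, h1,
      sub_smul, one_smul]
    abel
  have hone : ‖(1 : ell2 Γ →L[ℂ] ell2 Γ)‖ ≤ 1 := ContinuousLinearMap.norm_id_le
  have hterm : ∀ j, ‖(1 - c 1) • (1 : ell2 Γ →L[ℂ] ell2 Γ) -
      leftReg (γ j) * (a - b) * leftReg (γ j)⁻¹‖ ≤ 1 / 2 := by
    intro j
    refine (norm_sub_le _ _).trans ?_
    have h1 := norm_leftReg_conj_le (γ j) (a - b)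
    have h2 : ‖(1 - c 1) • (1 : ell2 Γ →L[ℂ] ell2 Γ)‖ ≤ 1 / 4 := by
      rw [norm_smul]
      nlinarith [norm_nonneg (1 - c 1)]
    linarith
  simp_rw [hdecomp]
  rw [Finset.sum_sub_distrib]
  refine (norm_sub_le _ _).trans_lt ?_
  have hfirst := (norm_sum_le Finset.univ _).trans
    (Finset.sum_le_sum fun j _ => hterm j)
  simp only [Finset.sum_const, Finset.card_univ, Fintype.card_fin, nsmul_eq_mul] at hfirst hest
  push_cast at hfirst hest ⊢
  rw [Real.sqrt_sq (Nat.cast_nonneg _)] at hest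
  nlinarith [norm_nonneg b₀]

-- A nonzero ideal contains a multiple of some y*y of trace one. By averaging its conjugates, which
-- stay in the ideal, one obtains an element at distance less than 1 from the identity, hence a
-- unit.
open Classical in
theorem IsPowersGroup.isCStarSimple (hΓ : IsPowersGroup Γ) : IsCStarSimple Γ := by
  intro I _
  rw [or_iff_not_imp_left]
  intro hI
  obtain ⟨x, hxI, hx⟩ : ∃ x ∈ I, x ≠ 0 := by
    by_contra! h
    exact hI (le_bot_iff.1 fun x hx => TwoSidedIdeal.mem_bot _ |>.2 (h x hx))
  let u : Γ → reducedCStar Γ := fun g => ⟨leftReg g, leftReg_mem_reducedCStar g⟩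
  obtain ⟨g, hg⟩ := exists_apply_single_ne_zero (x := (x : ell2 Γ →L[ℂ] ell2 Γ))
    fun h => hx (Subtype.ext h)
  set y : reducedCStar Γ := x * u g with hy
  set δ₁ : ell2 Γ := lp.single 2 (1 : Γ) (1 : ℂ) with hδ₁
  have hyδ : (y : ell2 Γ →L[ℂ] ell2 Γ) δ₁ = (x : ell2 Γ →L[ℂ] ell2 Γ) (lp.single 2 g 1) := by
    change (x : ell2 Γ →L[ℂ] ell2 Γ) (leftReg g δ₁) = _
    rw [hδ₁, leftReg_single, mul_one]
  -- The trace of y*y is ⟨δ₁, y*yδ₁⟩ = ‖yδ₁‖², nonzero by the choice of g.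
  set r : ℂ := ((‖(y : ell2 Γ →L[ℂ] ell2 Γ) δ₁‖ : ℂ) ^ 2)⁻¹ with hr
  set a : reducedCStar Γ := r • (star y * y) with ha
  have haI : a ∈ I := by
    have : a = (r • star y) * (x * u g) := by rw [ha, smul_mul_assoc]
    rw [this]
    exact I.mul_mem_left _ _ (I.mul_mem_right _ _ hxI)
  have htr : ((a : ell2 Γ →L[ℂ] ell2 Γ) δ₁ : Γ → ℂ) 1 = 1 := by
    have h1 : ((a : ell2 Γ →L[ℂ] ell2 Γ) δ₁ : Γ → ℂ) 1 =
        inner ℂ δ₁ ((a : ell2 Γ →L[ℂ] ell2 Γ) δ₁) := by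
      rw [hδ₁, lp.inner_single_left]
      simp
    rw [h1]
    change inner ℂ δ₁ (r • ContinuousLinearMap.adjoint (y : ell2 Γ →L[ℂ] ell2 Γ)
      ((y : ell2 Γ →L[ℂ] ell2 Γ) δ₁)) = 1
    rw [inner_smul_right, ContinuousLinearMap.adjoint_inner_right, inner_self_eq_norm_sq_to_K]
    refine inv_mul_cancel₀ (pow_ne_zero _ ?_)
    rw [hyδ]
    simpa using hg
  obtain ⟨N, γ, hN, hnorm⟩ := hΓ.exists_average a.2 htr
  set s : reducedCStar Γ := ∑ j, (1 - u (γ j) * a * u (γ j)⁻¹) with hs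
  have hsnorm : ‖s‖ < N := by
    have : (s : ell2 Γ →L[ℂ] ell2 Γ) = ∑ j, (1 - leftReg (γ j) * a * leftReg (γ j)⁻¹) := by
      rw [hs, AddSubmonoidClass.coe_finsetSum]
      rfl
    rw [← this] at hnorm
    exact hnorm
  have hN0 : (0 : ℝ) < N := by exact_mod_cast hN
  have : CompleteSpace (reducedCStar Γ) :=
    (StarSubalgebra.isClosed_topologicalClosure _).completeSpace_coe
  have hunit : IsUnit (1 - (N : ℂ)⁻¹ • s) := by
    refine isUnit_one_sub_of_norm_lt_one ?_
    rw [norm_smul, norm_inv, Complex.norm_natCast, inv_mul_lt_one₀ hN0]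
    exact hsnorm
  have hmem : 1 - (N : ℂ)⁻¹ • s ∈ I := by
    have hN0' : (N : ℂ) ≠ 0 := by exact_mod_cast hN0.ne'
    have : 1 - (N : ℂ)⁻¹ • s = ((N : ℂ)⁻¹ • 1) * ∑ j, u (γ j) * a * u (γ j)⁻¹ := by
      rw [hs, Finset.sum_sub_distrib, smul_sub, smul_one_mul]
      simp [← Nat.cast_smul_eq_nsmul ℂ, smul_smul, hN0']
    rw [this]
    exact I.mul_mem_left _ _ (sum_mem fun j _ => I.mul_mem_right _ _ (I.mul_mem_left _ _ haI))
  rw [← I.one_mem_iff]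
  obtain ⟨v, hv⟩ := hunit
  rw [← hv] at hmem
  simpa using I.mul_mem_left (↑v⁻¹) _ hmem

end CStar

end HNNPowers

/-! ### The main theorem -/

theorem mainTheorem4 {G : Type*} [Group G] {H K : Subgroup G} (θ : H ≃* K)
    (S : HNNPowers.LeftReps H K) (hna : HNNPowers.NonAscending θ) :
    (∀ ε : ℤˣ, Subgroup.normalClosure
        (HNNPowers.quasiKernel θ S ε : Set (HNNExtension G H K θ)) = HNNPowers.interior θ S) ∧
    List.TFAE [
      HNNPowers.interior θ S = ⊥,
      ∃ ε : ℤˣ, HNNPowers.quasiKernel θ S ε = ⊥,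
      ∀ ε : ℤˣ, HNNPowers.quasiKernel θ S ε = ⊥,
      HNNPowers.FiniteConjAvoids Set.univ (HNNPowers.baseG θ : Set (HNNExtension G H K θ)),
      HNNPowers.FiniteConjAvoids Set.univ (HNNPowers.baseH θ : Set (HNNExtension G H K θ)),
      HNNPowers.FiniteConjAvoids (HNNPowers.baseG θ : Set (HNNExtension G H K θ))
        (HNNPowers.baseH θ),
      HNNPowers.FiniteConjAvoids (HNNPowers.baseH θ : Set (HNNExtension G H K θ))
        (HNNPowers.baseH θ)] ∧
    (HNNPowers.interior θ S = ⊥ →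
      HNNPowers.IsPowersGroup (HNNExtension G H K θ) ∧
      HNNPowers.IsCStarSimple (HNNExtension G H K θ)) := by
  refine ⟨HNNPowers.normalClosure_quasiKernel hna S, ?_, fun h => ?_⟩
  · tfae_have 1 ↔ 3 := HNNPowers.interior_eq_bot_iff.trans
      ⟨fun h => HNNPowers.quasiKernel_eq_bot_of_exists hna ⟨_, h⟩, fun h => h _⟩
    tfae_have 2 → 3 := HNNPowers.quasiKernel_eq_bot_of_exists hna
    tfae_have 3 → 2 := fun h => ⟨1, h 1⟩
    tfae_have 3 → 4 := fun h => HNNPowers.finiteConjAvoids_baseG hna (h _)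
    tfae_have 4 → 5 := fun h => h.mono subset_rfl HNNPowers.baseH_le_baseG
    tfae_have 5 → 6 := fun h => h.mono (Set.subset_univ _) subset_rfl
    tfae_have 6 → 7 := fun h => h.mono HNNPowers.baseH_le_baseG subset_rfl
    tfae_have 7 → 3 := HNNPowers.quasiKernel_eq_bot_of_finiteConjAvoids hna
    tfae_finish
  · have hP := HNNPowers.isPowersGroup_of_quasiKernel_eq_bot hna
      (HNNPowers.interior_eq_bot_iff.1 h)
    exact ⟨hP, hP.isCStarSimple⟩
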